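/- Let $(M,g)$ be a smooth Lorentzian manifold (Hausdorff, non-empty, without boundary, signature $(-,+,\dots,+)$) of dimension $n\ge 3$. Assume that on $M$ there is a smooth flow $(\varphi_t)_{t\in\mathbb R}$ (a one-parameter group of diffeomorphisms) whose velocity vector field $\xi$ is smooth, unit timelike ($g(\xi,\xi)=-1$ everywhere) and compactly supported. Let $dv$ be the canonical volume element of $g$, given by $dv(v_1,\dots,v_n)=\sqrt{|\det (g(v_i,v_j))|}$ (in coordinates $\sqrt{|\det g|}$; no orientation of $M$ is needed), let $$L_\xi dv=\frac{d}{dt}\Big|_{t=0}\varphi_t^*dv=(\operatorname{div}\xi)\,dv$$ be the rate of volumetric expansion of the flow, and let the function $\operatorname{div}\xi$ be its logarithmic rate of volumetric expansion. Say that the rate $L_\xi dv$ increases (decreases) along the trajectories of the flow if, for all $x\in M$ and all $v_1,\dots,v_n\in T_xM$, the function $t\mapsto(\varphi_t^*(L_\xi dv))(v_1,\dots,v_n)$ is nondecreasing (nonincreasing) on $\mathbb R$, and for at least one choice of $x,v_1,\dots,v_n$ it is not constant. Say that $\operatorname{div}\xi$ increases along the trajectories if $t\mapsto(\operatorname{div}\xi)(\varphi_t(x))$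 is nondecreasing on $\mathbb R$ for all $x\in M$ and not constant for at least one $x$. (Strict monotonicity along every trajectory, with $v_1,\dots,v_n$ a basis in the case of $L_\xi dv$, is a special case.) Then the rate of volumetric expansion $L_\xi dv$ neither increases nor decreases along the trajectories of the flow and, in particular, the logarithmic rate of volumetric expansion $\operatorname{div}\xi$ does not increase along them. -/

import Mathlib

open scoped Manifold ContDiff Topology
open Bundle

noncomputable section

section Lorentz

variable (n : ℕ) (M : Type*) [TopologicalSpace M] [ChartedSpace (EuclideanSpace ℝ (Fin n)) M]
  [IsManifold (𝓡 n) ∞ M]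

/-- A smooth Lorentzian metric, of signature `(-,+,…,+)`, on an `n`-dimensional smooth manifold
without boundary. -/
structure LorentzianMetric where
  /-- the scalar product on each tangent space -/
  inner (x : M) : TangentSpace (𝓡 n) x →L[ℝ] TangentSpace (𝓡 n) x →L[ℝ] ℝ
  symm (x : M) (v w : TangentSpace (𝓡 n) x) : inner x v w = inner x w v
  /-- each tangent space has a pseudo-orthonormal basis with exactly one timelike vector -/
  signature (x : M) : ∃ (b : Module.Basis (Fin n) ℝ (TangentSpace (𝓡 n) x)) (k : Fin n),
    ∀ i j, inner x (b i) (b j) = if i = j then (if i = k then -1 else 1) else 0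
  contMDiff : ContMDiff (𝓡 n) ((𝓡 n).prod
      𝓘(ℝ, EuclideanSpace ℝ (Fin n) →L[ℝ] EuclideanSpace ℝ (Fin n) →L[ℝ] ℝ)) ∞
    (fun x ↦ TotalSpace.mk' (EuclideanSpace ℝ (Fin n) →L[ℝ] EuclideanSpace ℝ (Fin n) →L[ℝ] ℝ)
      x (inner x))

end Lorentz

section Volume

variable {n : ℕ} {M : Type*} [TopologicalSpace M] [ChartedSpace (EuclideanSpace ℝ (Fin n)) M]

variable (n M) in
/-- Fields on `M` which take a real value on every `n`-tuple of tangent vectors at a point, such as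
the covariant `n`-tensor fields, the differential `n`-forms and the densities. -/
abbrev FrameField : Type _ := (x : M) → (Fin n → TangentSpace (𝓡 n) x) → ℝ

/-- The pullback `f^* T` of such a field `T` by a map `f : M → M`. -/
def framePullback (f : M → M) (T : FrameField n M) : FrameField n M :=
  fun x v ↦ T (f x) (fun i ↦ mfderiv (𝓡 n) (𝓡 n) f x (v i))

/-- The Lie derivative `d/dt (φ_t^* T)` at `t = 0` along a flow `φ`. -/
def flowLieDeriv (φ : Flow ℝ M) (T : FrameField n M) : FrameField n M :=
  fun x v ↦ deriv (fun t : ℝ ↦ framePullback (φ t) T x v) 0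

variable [IsManifold (𝓡 n) ∞ M]

/-- The canonical volume element `dv` of the metric, `dv (v₁, …, vₙ) = √|det (g (vᵢ, vⱼ))|`.
In coordinates `dv (∂₁, …, ∂ₙ) = √|det g|`.  No orientation is needed; on an oriented manifold this
is, on positively oriented frames, the value of the volume form `√|det g| dx¹ ∧ … ∧ dxⁿ`. -/
def LorentzianMetric.volumeElement (g : LorentzianMetric n M) : FrameField n M :=
  fun x v ↦ Real.sqrt |(Matrix.of fun i j ↦ g.inner x (v i) (v j)).det|

/-- The rate of volumetric expansion: the Lie derivative `L_ξ dv` of the volume element along the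
flow `φ` with velocity `ξ`. -/
def expansionRate (g : LorentzianMetric n M) (φ : Flow ℝ M) : FrameField n M :=
  flowLieDeriv φ g.volumeElement

/-- The coordinate frame at `x` of the preferred chart at `x`. -/
def coordFrame (x : M) : Fin n → TangentSpace (𝓡 n) x :=
  fun i ↦ (EuclideanSpace.single i (1 : ℝ) : EuclideanSpace ℝ (Fin n))

/-- The logarithmic rate of volumetric expansion: the function `div ξ` with
`L_ξ dv = (div ξ) dv`, see `expansionRate_eq`. -/
def logExpansionRate (g : LorentzianMetric n M) (φ : Flow ℝ M) (x : M) : ℝ :=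
  expansionRate g φ x (coordFrame x) / g.volumeElement x (coordFrame x)

lemma volumeElement_comp (g : LorentzianMetric n M) (y : M) (w : Fin n → TangentSpace (𝓡 n) y)
    (P : Matrix (Fin n) (Fin n) ℝ) :
    g.volumeElement y (fun i ↦ ∑ k, P i k • w k) = |P.det| * g.volumeElement y w := by
  have h : (Matrix.of fun i j ↦ g.inner y (∑ k, P i k • w k) (∑ k, P j k • w k))
      = P * (Matrix.of fun i j ↦ g.inner y (w i) (w j)) * P.transpose := by
    ext i j
    simp only [Matrix.of_apply, Matrix.mul_apply, Matrix.transpose_apply, map_sum, map_smul,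
      sum_apply, smul_apply, smul_eq_mul,
      Finset.sum_mul, Finset.mul_sum]
    refine Finset.sum_congr rfl fun a _ ↦ Finset.sum_congr rfl fun b _ ↦ by ring
  unfold LorentzianMetric.volumeElement
  rw [h, Matrix.det_mul, Matrix.det_mul, Matrix.det_transpose,
    show ∀ a b : ℝ, a * b * a = a ^ 2 * b by intros; ring, abs_mul,
    Real.sqrt_mul (abs_nonneg _), abs_of_nonneg (sq_nonneg P.det), Real.sqrt_sq_eq_abs]

lemma eq_sum_coordFrame (x : M) (v : Fin n → TangentSpace (𝓡 n) x) :
    ∃ P : Matrix (Fin n) (Fin n) ℝ, v = fun i ↦ ∑ k, P i k • coordFrame x k := by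
  let b := (EuclideanSpace.basisFun (Fin n) ℝ).toBasis
  refine ⟨fun i k ↦ b.repr (v i) k, funext fun i ↦ ?_⟩
  have := (b.sum_repr (v i)).symm
  simp only [b, OrthonormalBasis.coe_toBasis, EuclideanSpace.basisFun_apply] at this
  exact this

lemma volumeElement_coordFrame_ne_zero (g : LorentzianMetric n M) (x : M) :
    g.volumeElement x (coordFrame x) ≠ 0 := by
  obtain ⟨b, k, hb⟩ := g.signature x
  obtain ⟨P, hP⟩ := eq_sum_coordFrame x b
  have h1 : g.volumeElement x b = 1 := by
    have : (Matrix.of fun i j ↦ g.inner x (b i) (b j))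
        = Matrix.diagonal fun i ↦ if i = k then (-1 : ℝ) else 1 := by
      ext i j
      simp only [Matrix.of_apply, hb, Matrix.diagonal_apply]
    unfold LorentzianMetric.volumeElement
    rw [this, Matrix.det_diagonal, Finset.prod_ite_eq' ]
    simp
  intro h0
  rw [hP, volumeElement_comp, h0, mul_zero] at h1
  exact zero_ne_one h1

/-- The defining relation `L_ξ dv = (div ξ) dv` of the logarithmic rate. -/
theorem expansionRate_eq (g : LorentzianMetric n M) (φ : Flow ℝ M) (x : M)
    (v : Fin n → TangentSpace (𝓡 n) x) :
    expansionRate g φ x v = logExpansionRate g φ x * g.volumeElement x v := by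
  obtain ⟨P, rfl⟩ := eq_sum_coordFrame x v
  have h : (fun t : ℝ ↦ framePullback (φ t) g.volumeElement x
        (fun i ↦ ∑ k, P i k • coordFrame x k))
      = fun t ↦ |P.det| * framePullback (φ t) g.volumeElement x (coordFrame x) := by
    funext t
    simp only [framePullback, map_sum, map_smul]
    exact volumeElement_comp g _ _ P
  have h2 : expansionRate g φ x (fun i ↦ ∑ k, P i k • coordFrame x k)
      = |P.det| * expansionRate g φ x (coordFrame x) := by
    simp only [expansionRate, flowLieDeriv]
    rw [h, deriv_const_mul_field]
  rw [h2, volumeElement_comp, logExpansionRate]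
  field_simp [volumeElement_coordFrame_ne_zero g x]

end Volume

section Trajectories

variable {n : ℕ} {M : Type*} [TopologicalSpace M] [ChartedSpace (EuclideanSpace ℝ (Fin n)) M]

/-- The field `T` increases along the trajectories of `φ`: for each frame `v` at each point `x`,
the value `(φ_t^* T)(v)` at the point `φ_t x` of the trajectory of `x`, on the frame carried along
by the flow, never decreases with `t`, and for at least one choice of `x` and `v` it does grow.
(Strict growth along every trajectory is the special case in which it grows for all frames `v`; the
volume element and its rate vanish on linearly dependent tuples.) -/
def FrameFieldIncreases (φ : Flow ℝ M) (T : FrameField n M) : Prop :=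
  (∀ x v, Monotone fun t : ℝ ↦ framePullback (φ t) T x v) ∧
    ∃ x v, ∃ s t : ℝ, s < t ∧ framePullback (φ s) T x v < framePullback (φ t) T x v

/-- The field `T` decreases along the trajectories of `φ`: never increases, and falls somewhere. -/
def FrameFieldDecreases (φ : Flow ℝ M) (T : FrameField n M) : Prop :=
  (∀ x v, Antitone fun t : ℝ ↦ framePullback (φ t) T x v) ∧
    ∃ x v, ∃ s t : ℝ, s < t ∧ framePullback (φ t) T x v < framePullback (φ s) T x v

/-- The function `f` increases along the trajectories of `φ`: it never decreases along any of them,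
and it does grow along at least one of them. -/
def FunctionIncreases (φ : Flow ℝ M) (f : M → ℝ) : Prop :=
  (∀ x, Monotone fun t : ℝ ↦ f (φ t x)) ∧ ∃ x, ∃ s t : ℝ, s < t ∧ f (φ s x) < f (φ t x)

end Trajectories

end

/-! Since `ξ` has no zeros and compact support, `M` is compact. For a tuple `v` at `x` put V(t) =
(φ_t^* dv)(v) ≥ 0. By the group law V'(t) = (φ_t^* L_ξ dv)(v)
(`hasDerivAt_framePullback_volumeElement`), so monotonicity of the rate is convexity or concavity of
V.

If the rate is nonincreasing, V is concave on the whole line and bounded below by 0, hence constant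
(`ConvexOn.eq_of_le` for -V).

If it is nondecreasing, V is convex, which a single trajectory does not exclude. Here the total
volume enters: each φ_t is a diffeomorphism of a compact manifold, so φ_t^* dv and dv have the same
integral (`LorentzianMetric.sum_setIntegral_mapDensity_comp`). The second difference φ_t^* dv +
φ_{-t}^* dv - 2 dv is continuous, nonnegative and of integral zero, so it vanishes
(`framePullback_midpoint_eq`). Hence V(t) ≤ 2 V(0), and a bounded convex function on the line is
constant.

In both cases the rate vanishes, contradicting the strict change somewhere. On a frame, div ξ along
the trajectory is (log V)'; if it is nondecreasing, log V and therefore V are convex, and the second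
case applies. -/

noncomputable section

/-! ### Regularity of the metric and its volume element along maps -/

section Regularity

variable {n : ℕ} {M : Type*} [TopologicalSpace M] [ChartedSpace (EuclideanSpace ℝ (Fin n)) M]
  [IsManifold (𝓡 n) ∞ M]
  {E' H' N : Type*} [NormedAddCommGroup E'] [NormedSpace ℝ E'] [TopologicalSpace H']
  {J : ModelWithCorners ℝ E' H'} [TopologicalSpace N] [ChartedSpace H' N]

/-- The scalar product of two vector fields along a map is as regular as the fields. -/
lemma LorentzianMetric.contMDiffAt_inner (g : LorentzianMetric n M) {r : WithTop ℕ∞}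
    [IsManifold (𝓡 n) (r + 1) M]
    (hr : r ≤ ∞) {b : N → M} {V W : ∀ m, TangentSpace (𝓡 n) (b m)} {m : N}
    (hV : ContMDiffAt J (𝓡 n).tangent r
      (fun m ↦ (⟨b m, V m⟩ : TangentBundle (𝓡 n) M)) m)
    (hW : ContMDiffAt J (𝓡 n).tangent r
      (fun m ↦ (⟨b m, W m⟩ : TangentBundle (𝓡 n) M)) m) :
    ContMDiffAt J 𝓘(ℝ, ℝ) r (fun m ↦ g.inner (b m) (V m) (W m)) m := by
  have hb : ContMDiffAt J (𝓡 n) r b m := (contMDiffAt_totalSpace.1 hV).1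
  have : ContMDiffAt J ((𝓡 n).prod 𝓘(ℝ, ℝ)) r
      (fun m ↦ TotalSpace.mk' ℝ (E := Bundle.Trivial M ℝ) (b m)
        (g.inner (b m) (V m) (W m))) m := by
    apply ContMDiffAt.clm_bundle_apply₂ (F₁ := EuclideanSpace ℝ (Fin n))
      (F₂ := EuclideanSpace ℝ (Fin n))
    · exact ContMDiffAt.comp m (g.contMDiff.of_le hr).contMDiffAt hb
    · exact hV
    · exact hW
  exact (contMDiffAt_totalSpace.1 this).2

/-- The Gram determinant of vector fields along a map is as regular as the fields. -/
lemma LorentzianMetric.contMDiffAt_det_gram (g : LorentzianMetric n M) {r : WithTop ℕ∞}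
    [IsManifold (𝓡 n) (r + 1) M]
    (hr : r ≤ ∞) {b : N → M} {V : ∀ m, Fin n → TangentSpace (𝓡 n) (b m)} {m : N}
    (hV : ∀ i, ContMDiffAt J (𝓡 n).tangent r
      (fun m ↦ (⟨b m, V m i⟩ : TangentBundle (𝓡 n) M)) m) :
    ContMDiffAt J 𝓘(ℝ, ℝ) r
      (fun m ↦ (Matrix.of fun i j ↦ g.inner (b m) (V m i) (V m j)).det) m := by
  simp only [Matrix.det_apply', Matrix.of_apply]
  refine ContMDiffAt.sum fun σ _ ↦ ContMDiffAt.mul contMDiffAt_const ?_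
  exact ContMDiffAt.prod fun i _ ↦ g.contMDiffAt_inner hr (hV _) (hV _)

lemma one_add_one_le_infty : (1 : WithTop ℕ∞) + 1 ≤ ∞ := by
  rw [one_add_one_eq_two]
  exact ENat.LEInfty.out

/-- The tangent bundle loses one derivative, so regularity 0 and 1 of vector fields needs the base
to be of class 1 and 2. -/
instance : IsManifold (𝓡 n) (0 + 1) M := IsManifold.of_le (n := ∞) (by simp)
instance : IsManifold (𝓡 n) (1 + 1) M := IsManifold.of_le (n := ∞) one_add_one_le_infty

lemma LorentzianMetric.continuousAt_volumeElement (g : LorentzianMetric n M)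
    {b : N → M} {V : ∀ m, Fin n → TangentSpace (𝓡 n) (b m)} {m : N}
    (hV : ∀ i, ContMDiffAt J (𝓡 n).tangent 0
      (fun m ↦ (⟨b m, V m i⟩ : TangentBundle (𝓡 n) M)) m) :
    ContinuousAt (fun m ↦ g.volumeElement (b m) (V m)) m :=
  (g.contMDiffAt_det_gram (by simp) hV).continuousAt.abs.sqrt

/-- Both the absolute value and the square root are singular at 0, so differentiability, unlike
continuity, needs a nonzero Gram determinant. -/
lemma LorentzianMetric.differentiableAt_volumeElement (g : LorentzianMetric n M)
    {b : ℝ → M} {V : ∀ m, Fin n → TangentSpace (𝓡 n) (b m)} {m : ℝ}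
    (hV : ∀ i, ContMDiffAt 𝓘(ℝ, ℝ) (𝓡 n).tangent 1
      (fun m ↦ (⟨b m, V m i⟩ : TangentBundle (𝓡 n) M)) m)
    (h0 : g.volumeElement (b m) (V m) ≠ 0) :
    DifferentiableAt ℝ (fun m ↦ g.volumeElement (b m) (V m)) m := by
  have h := (g.contMDiffAt_det_gram (by simp) hV).contDiffAt.differentiableAt one_ne_zero
  have h1 : (Matrix.of fun i j ↦ g.inner (b m) (V m i) (V m j)).det ≠ 0 := by
    intro h
    simp [LorentzianMetric.volumeElement, h] at h0
  exact (h.abs h1).sqrt (abs_ne_zero.2 h1)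

end Regularity

/-! ### Algebra of pulled-back volume elements -/

section Pullback

variable {n : ℕ} {M : Type*} [TopologicalSpace M] [ChartedSpace (EuclideanSpace ℝ (Fin n)) M]

lemma framePullback_comp {f h : M → M} {T : FrameField n M}
    (hf : MDifferentiable (𝓡 n) (𝓡 n) f) (hh : MDifferentiable (𝓡 n) (𝓡 n) h)
    (x : M) (v : Fin n → TangentSpace (𝓡 n) x) :
    framePullback (f ∘ h) T x v
      = framePullback f T (h x) (fun i ↦ mfderiv (𝓡 n) (𝓡 n) h x (v i)) := by
  simp only [framePullback, mfderiv_comp x (hf (h x)) (hh x)]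
  rfl

variable [IsManifold (𝓡 n) ∞ M]

lemma framePullback_volumeElement_comp (g : LorentzianMetric n M) (f : M → M) (x : M)
    (w : Fin n → TangentSpace (𝓡 n) x) (P : Matrix (Fin n) (Fin n) ℝ) :
    framePullback f g.volumeElement x (fun i ↦ ∑ k, P i k • w k)
      = |P.det| * framePullback f g.volumeElement x w := by
  simp only [framePullback, map_sum, map_smul]
  exact volumeElement_comp g _ _ P

lemma framePullback_volumeElement_nonneg (g : LorentzianMetric n M) (f : M → M) (x : M)
    (w : Fin n → TangentSpace (𝓡 n) x) : 0 ≤ framePullback f g.volumeElement x w :=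
  Real.sqrt_nonneg _

lemma framePullback_id_volumeElement (g : LorentzianMetric n M) (x : M)
    (v : Fin n → TangentSpace (𝓡 n) x) :
    framePullback id g.volumeElement x v = g.volumeElement x v := by
  simp only [framePullback, mfderiv_id]
  rfl

/-- The pullback of the volume element under a map with a differentiable left inverse is
non-degenerate. -/
lemma framePullback_volumeElement_ne_zero (g : LorentzianMetric n M) {f h : M → M}
    (hf : MDifferentiable (𝓡 n) (𝓡 n) f) (hh : MDifferentiable (𝓡 n) (𝓡 n) h)
    (hfh : f ∘ h = id) {x : M} {v : Fin n → TangentSpace (𝓡 n) x}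
    (hv : g.volumeElement x v ≠ 0) : framePullback h g.volumeElement x v ≠ 0 := by
  intro h0
  apply hv
  rw [← framePullback_id_volumeElement g x v, ← hfh, framePullback_comp hf hh]
  -- If the image tuple were degenerate, its coordinate matrix `P` would have determinant 0, and
  -- pulling back further by `f` would still give 0.
  obtain ⟨P, hP⟩ := eq_sum_coordFrame (h x) (fun i ↦ mfderiv (𝓡 n) (𝓡 n) h x (v i))
  simp only [framePullback] at h0
  rw [hP, volumeElement_comp] at h0
  rw [hP, framePullback_volumeElement_comp,
    (mul_eq_zero.1 h0).resolve_right (volumeElement_coordFrame_ne_zero g _), zero_mul]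

end Pullback

/-! ### Differentiating the volume element along the flow -/

section FlowDerivative

variable {n : ℕ} {M : Type*} [TopologicalSpace M] [ChartedSpace (EuclideanSpace ℝ (Fin n)) M]

lemma Flow.comp_eq (φ : Flow ℝ M) (s t : ℝ) : φ (s + t) = φ s ∘ φ t :=
  funext fun x ↦ φ.map_add s t x

lemma Flow.contMDiff_time {φ : Flow ℝ M}
    (hφ : ContMDiff (𝓘(ℝ, ℝ).prod (𝓡 n)) (𝓡 n) ∞ (fun p : ℝ × M ↦ φ p.1 p.2)) (t : ℝ) :
    ContMDiff (𝓡 n) (𝓡 n) ∞ (φ t) :=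
  hφ.comp (contMDiff_const.prodMk contMDiff_id)

lemma Flow.mdifferentiable_time {φ : Flow ℝ M}
    (hφ : ContMDiff (𝓘(ℝ, ℝ).prod (𝓡 n)) (𝓡 n) ∞ (fun p : ℝ × M ↦ φ p.1 p.2)) (t : ℝ) :
    MDifferentiable (𝓡 n) (𝓡 n) (φ t) :=
  (Flow.contMDiff_time hφ t).mdifferentiable (by simp)

variable [IsManifold (𝓡 n) ∞ M]

/-- The curve is the tangent map of (t, x) ↦ φ_t x applied to the vector with time component 0 and
space component `v`, so it inherits joint smoothness of the flow. -/
lemma Flow.contMDiff_mfderiv_apply {φ : Flow ℝ M}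
    (hφ : ContMDiff (𝓘(ℝ, ℝ).prod (𝓡 n)) (𝓡 n) ∞ (fun p : ℝ × M ↦ φ p.1 p.2))
    (x : M) (v : TangentSpace (𝓡 n) x) :
    ContMDiff 𝓘(ℝ, ℝ) (𝓡 n).tangent 1
      (fun t : ℝ ↦ (⟨φ t x, mfderiv (𝓡 n) (𝓡 n) (φ t) x v⟩ : TangentBundle (𝓡 n) M)) := by
  have h1 : ContMDiff 𝓘(ℝ, ℝ) 𝓘(ℝ, ℝ).tangent 1
      (fun t : ℝ ↦ (⟨t, (0 : ℝ)⟩ : TangentBundle 𝓘(ℝ, ℝ) ℝ)) :=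
    contMDiff_zeroSection ℝ (TangentSpace 𝓘(ℝ, ℝ))
  have h2 : ContMDiff 𝓘(ℝ, ℝ) (𝓡 n).tangent 1
      (fun _ : ℝ ↦ (⟨x, v⟩ : TangentBundle (𝓡 n) M)) := contMDiff_const
  have : IsManifold (𝓡 n) 1 M := IsManifold.of_le (n := ∞) (by simp)
  have h3 := (contMDiff_equivTangentBundleProd_symm (n := 1) (I := 𝓘(ℝ, ℝ)) (M := ℝ)
    (I' := 𝓡 n) (M' := M)).comp (h1.prodMk h2)
  have h4 := (hφ.contMDiff_tangentMap (m := 1) one_add_one_le_infty).comp h3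
  convert h4 using 1
  funext t
  have hd : MDifferentiableAt (𝓘(ℝ, ℝ).prod (𝓡 n)) (𝓡 n) (fun p : ℝ × M ↦ φ p.1 p.2) (t, x) :=
    hφ.mdifferentiable (by simp) _
  have h5 := mfderiv_prod_eq_add_apply hd
    (v := (@Prod.mk ℝ (EuclideanSpace ℝ (Fin n)) 0 v))
  refine congrArg (TotalSpace.mk (φ t x)) ?_
  exact (h5.trans ((congrArg (· + _) (ContinuousLinearMap.map_zero _)).trans (zero_add _))).symm

/-- The derivative of the pullback of the volume element along the trajectories. -/
lemma hasDerivAt_framePullback_volumeElement (g : LorentzianMetric n M) {φ : Flow ℝ M}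
    (hφ : ContMDiff (𝓘(ℝ, ℝ).prod (𝓡 n)) (𝓡 n) ∞ (fun p : ℝ × M ↦ φ p.1 p.2))
    (x : M) (v : Fin n → TangentSpace (𝓡 n) x) (t : ℝ) :
    HasDerivAt (fun s : ℝ ↦ framePullback (φ s) g.volumeElement x v)
      (framePullback (φ t) (expansionRate g φ) x v) t := by
  have hd := Flow.mdifferentiable_time hφ
  have hdiff : DifferentiableAt ℝ (fun s : ℝ ↦ framePullback (φ s) g.volumeElement x v) t := by
    -- `v` may be degenerate; pulling out |det P| leaves the coordinate frame, on which the volume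
    -- never vanishes.
    obtain ⟨P, rfl⟩ := eq_sum_coordFrame x v
    simp only [framePullback_volumeElement_comp]
    refine DifferentiableAt.const_mul (g.differentiableAt_volumeElement
      (fun i ↦ Flow.contMDiff_mfderiv_apply hφ x _ t) ?_) _
    refine framePullback_volumeElement_ne_zero g (hd (-t)) (hd t) ?_
      (volumeElement_coordFrame_ne_zero g x)
    rw [← Flow.comp_eq, neg_add_cancel]
    exact funext φ.map_zero_apply
  refine hdiff.hasDerivAt.congr_deriv (Eq.symm ?_)
  -- The group law turns the derivative at 0 based at φ_t x into the derivative at `t` based at `x`.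
  have h : (fun s : ℝ ↦ framePullback (φ s) g.volumeElement (φ t x)
      (fun i ↦ mfderiv (𝓡 n) (𝓡 n) (φ t) x (v i)))
      = fun s : ℝ ↦ framePullback (φ (s + t)) g.volumeElement x v := by
    funext s
    rw [Flow.comp_eq, framePullback_comp (hd s) (hd t)]
  change deriv (fun s : ℝ ↦ framePullback (φ s) g.volumeElement (φ t x)
      (fun i ↦ mfderiv (𝓡 n) (𝓡 n) (φ t) x (v i))) 0 = _
  rw [h,
    deriv_comp_add_const (fun s : ℝ ↦ framePullback (φ s) g.volumeElement x v), zero_add]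

end FlowDerivative

/-! ### Integrability in charts and finite partitions of unity -/

section ChartIntegration

open MeasureTheory

variable {n : ℕ} {M : Type*} [TopologicalSpace M] [ChartedSpace (EuclideanSpace ℝ (Fin n)) M]

/-- A continuous function supported in a chart domain is integrable in the chart against any
continuous density. -/
lemma integrableOn_chart [CompactSpace M] {c : M} {w : M → ℝ} (hwc : Continuous w)
    (hw : tsupport w ⊆ (chartAt (EuclideanSpace ℝ (Fin n)) c).source)
    {D : EuclideanSpace ℝ (Fin n) → ℝ}
    (hD : ContinuousOn D (chartAt (EuclideanSpace ℝ (Fin n)) c).target) :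
    IntegrableOn (fun y ↦ w ((chartAt (EuclideanSpace ℝ (Fin n)) c).symm y) * D y)
      (chartAt (EuclideanSpace ℝ (Fin n)) c).target := by
  set e := chartAt (EuclideanSpace ℝ (Fin n)) c
  have hK : IsCompact (e '' tsupport w) :=
    (isClosed_tsupport w).isCompact.image_of_continuousOn (e.continuousOn.mono hw)
  have hKt : e '' tsupport w ⊆ e.target := by
    rintro _ ⟨x, hx, rfl⟩
    exact e.map_source (hw hx)
  have hcont : ContinuousOn (fun y ↦ w (e.symm y) * D y) e.target :=
    (hwc.comp_continuousOn e.continuousOn_symm).mul hD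
  -- `D` may be unbounded near the edge of the chart, but the integrand vanishes off the compact
  -- image of the support of `w`.
  refine IntegrableOn.of_forall_sdiff_eq_zero ((hcont.mono hKt).integrableOn_compact hK)
    e.open_target.measurableSet fun y hy ↦ ?_
  have : w (e.symm y) = 0 := by
    by_contra h0
    exact hy.2 ⟨e.symm y, subset_tsupport w h0, e.right_inv hy.1⟩
  rw [this, zero_mul]

variable (n M) in
-- Compactness leaves only finitely many nonzero members of a locally finite partition, so global
-- integrals become finite sums over charts.
lemma exists_finite_chart_partition [CompactSpace M] [T2Space M] :
    ∃ (s : Finset M) (ρ : M → M → ℝ), (∀ c, Continuous (ρ c)) ∧ (∀ c x, 0 ≤ ρ c x) ∧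
      (∀ c, tsupport (ρ c) ⊆ (chartAt (EuclideanSpace ℝ (Fin n)) c).source) ∧
      ∀ x, ∑ c ∈ s, ρ c x = 1 := by
  obtain ⟨P, hP⟩ := PartitionOfUnity.exists_isSubordinate (X := M) isClosed_univ
    (fun c : M ↦ (chartAt (EuclideanSpace ℝ (Fin n)) c).source)
    (fun c ↦ (chartAt _ c).open_source)
    (fun x _ ↦ Set.mem_iUnion.2 ⟨x, mem_chart_source _ x⟩)
  have hfin := P.locallyFinite.finite_nonempty_of_compact
  refine ⟨hfin.toFinset, fun c ↦ P c, fun c ↦ (P c).continuous, P.nonneg, hP, fun x ↦ ?_⟩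
  rw [← P.sum_eq_one (Set.mem_univ x), finsum_eq_sum_of_support_subset]
  intro c hc
  simp only [Set.Finite.coe_toFinset, Set.mem_ofPred_eq]
  exact ⟨x, hc⟩

end ChartIntegration

/-! ### Change of variables and invariance of total volume -/

section MapDensity

open MeasureTheory

variable {n : ℕ} {M : Type*} [TopologicalSpace M] [ChartedSpace (EuclideanSpace ℝ (Fin n)) M]
  [IsManifold (𝓡 n) ∞ M]

/-- The density with respect to Lebesgue measure of the pullback of the volume element under a
parametrization `u`. -/
def LorentzianMetric.mapDensity (g : LorentzianMetric n M) (u : EuclideanSpace ℝ (Fin n) → M)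
    (y : EuclideanSpace ℝ (Fin n)) : ℝ :=
  g.volumeElement (u y) (fun i ↦ mfderiv (𝓡 n) (𝓡 n) u y (coordFrame y i))

lemma LorentzianMetric.mapDensity_congr (g : LorentzianMetric n M)
    {u u' : EuclideanSpace ℝ (Fin n) → M} {y : EuclideanSpace ℝ (Fin n)} (h : u =ᶠ[𝓝 y] u') :
    g.mapDensity u y = g.mapDensity u' y := by
  -- All tangent spaces are the same model space, so the base point can be changed without
  -- transporting the vectors.
  have key : ∀ p q : M, p = q → ∀ v : Fin n → EuclideanSpace ℝ (Fin n),
      g.volumeElement p v = g.volumeElement q v := by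
    rintro p _ rfl v
    rfl
  simp only [LorentzianMetric.mapDensity, h.mfderiv_eq]
  exact key _ _ h.eq_of_nhds _

lemma LorentzianMetric.mapDensity_comp (g : LorentzianMetric n M) {f : M → M}
    {u : EuclideanSpace ℝ (Fin n) → M} {y : EuclideanSpace ℝ (Fin n)}
    (hf : MDifferentiableAt (𝓡 n) (𝓡 n) f (u y)) (hu : MDifferentiableAt (𝓡 n) (𝓡 n) u y) :
    g.mapDensity (f ∘ u) y = framePullback f g.volumeElement (u y)
      (fun i ↦ mfderiv (𝓡 n) (𝓡 n) u y (coordFrame y i)) := by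
  simp only [LorentzianMetric.mapDensity, framePullback, mfderiv_comp y hf hu]
  rfl

lemma LorentzianMetric.continuousOn_mapDensity (g : LorentzianMetric n M)
    {u : EuclideanSpace ℝ (Fin n) → M} {U : Set (EuclideanSpace ℝ (Fin n))} (hU : IsOpen U)
    (hu : ContMDiffOn (𝓡 n) (𝓡 n) ∞ u U) : ContinuousOn (g.mapDensity u) U := by
  have : IsManifold (𝓡 n) 1 M := IsManifold.of_le (n := ∞) (by simp)
  intro y hy
  refine (g.continuousAt_volumeElement (J := 𝓡 n) fun i ↦ ?_).continuousWithinAt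
  have h1 : ContMDiff (𝓡 n) (𝓡 n).tangent 0
      (fun z ↦ (⟨z, coordFrame z i⟩ : TangentBundle (𝓡 n) (EuclideanSpace ℝ (Fin n)))) :=
    contMDiff_vectorSpace_iff_contDiff.2 contDiff_const
  have h2 := (hu.contMDiffOn_tangentMapWithin (m := 0) (by simp) hU.uniqueMDiffOn).comp
    h1.contMDiffOn (s := U) (fun z hz ↦ hz)
  refine (h2.contMDiffAt (hU.mem_nhds hy)).congr_of_eventuallyEq ?_
  filter_upwards [hU.mem_nhds hy] with z hz
  simp only [Function.comp_apply, tangentMapWithin, mfderivWithin_of_isOpen hU hz]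

open scoped Matrix in
lemma LorentzianMetric.mapDensity_comp_right (g : LorentzianMetric n M)
    {u : EuclideanSpace ℝ (Fin n) → M}
    {ψ : EuclideanSpace ℝ (Fin n) → EuclideanSpace ℝ (Fin n)} {y : EuclideanSpace ℝ (Fin n)}
    (hu : MDifferentiableAt (𝓡 n) (𝓡 n) u (ψ y)) (hψ : DifferentiableAt ℝ ψ y) :
    g.mapDensity (u ∘ ψ) y = |(fderiv ℝ ψ y).det| * g.mapDensity u (ψ y) := by
  set b := (EuclideanSpace.basisFun (Fin n) ℝ).toBasis with hb
  -- The columns of `A` are the images of the basis, while `volumeElement_comp` reads coefficients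
  -- from rows; hence the transpose below.
  set A := LinearMap.toMatrix b b (fderiv ℝ ψ y).toLinearMap with hA
  have h1 : ∀ i, fderiv ℝ ψ y (coordFrame y i) = ∑ k, Aᵀ i k • coordFrame (ψ y) k := by
    intro i
    have h2 := b.sum_repr (fderiv ℝ ψ y (b i))
    simp only [hb, OrthonormalBasis.coe_toBasis, EuclideanSpace.basisFun_apply] at h2
    exact h2.symm
  have hdet : (fderiv ℝ ψ y).det = Aᵀ.det := by
    rw [Matrix.det_transpose, hA, LinearMap.det_toMatrix]
  have h3 : (fun i ↦ mfderiv (𝓡 n) (𝓡 n) (u ∘ ψ) y (coordFrame y i))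
      = fun i ↦ ∑ k, Aᵀ i k • mfderiv (𝓡 n) (𝓡 n) u (ψ y) (coordFrame (ψ y) k) := by
    funext i
    rw [mfderiv_comp y hu hψ.mdifferentiableAt, mfderiv_eq_fderiv]
    have := congrArg (mfderiv (𝓡 n) (𝓡 n) u (ψ y)) (h1 i)
    rw [map_sum] at this
    simp only [map_smul] at this
    exact this
  rw [hdet, LorentzianMetric.mapDensity, h3]
  exact volumeElement_comp g _ _ _

/-- Change of variables between two charts for the integral of the pullback of the volume element
under a diffeomorphism. -/
lemma LorentzianMetric.setIntegral_mapDensity_chart (g : LorentzianMetric n M) {f h : M → M}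
    (hf : ContMDiff (𝓡 n) (𝓡 n) ∞ f) (hhf : ∀ x, h (f x) = x)
    (hfh : ∀ x, f (h x) = x) {w w' : M → ℝ}
    {c c' : M} (hw : ∀ x ∉ (chartAt (EuclideanSpace ℝ (Fin n)) c).source, w x = 0)
    (hw' : ∀ x ∉ (chartAt (EuclideanSpace ℝ (Fin n)) c').source, w' x = 0) :
    ∫ y in (chartAt (EuclideanSpace ℝ (Fin n)) c).target,
      w ((chartAt (EuclideanSpace ℝ (Fin n)) c).symm y)
        * w' (f ((chartAt (EuclideanSpace ℝ (Fin n)) c).symm y))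
        * g.mapDensity (f ∘ (chartAt (EuclideanSpace ℝ (Fin n)) c).symm) y
    = ∫ z in (chartAt (EuclideanSpace ℝ (Fin n)) c').target,
      w (h ((chartAt (EuclideanSpace ℝ (Fin n)) c').symm z))
        * w' ((chartAt (EuclideanSpace ℝ (Fin n)) c').symm z)
        * g.mapDensity (chartAt (EuclideanSpace ℝ (Fin n)) c').symm z := by
  have he := contMDiffOn_chart_symm (I := 𝓡 n) (n := ∞) (x := c)
  have he1 := contMDiffOn_chart (I := 𝓡 n) (n := ∞) (x := c')
  have he2 := contMDiffOn_chart_symm (I := 𝓡 n) (n := ∞) (x := c')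
  set e := chartAt (EuclideanSpace ℝ (Fin n)) c
  set e' := chartAt (EuclideanSpace ℝ (Fin n)) c'
  -- The part of the first chart that `f` sends into the second chart. Off it, and off its image,
  -- one of the two weights is zero.
  set S := e.target ∩ e.symm ⁻¹' (f ⁻¹' e'.source) with hS
  have hSo : IsOpen S :=
    e.isOpen_inter_preimage_symm (e'.open_source.preimage hf.continuous)
  set ψ := e' ∘ f ∘ e.symm with hψ
  have himage : ψ '' S = e'.target ∩ e'.symm ⁻¹' (h ⁻¹' e.source) := by
    ext z
    constructor
    · rintro ⟨y, ⟨hy1, hy2⟩, rfl⟩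
      have hy2' : f (e.symm y) ∈ e'.source := hy2
      refine ⟨e'.map_source hy2', ?_⟩
      simp only [hψ, Set.mem_preimage, Function.comp_apply, e'.left_inv hy2', hhf]
      exact e.map_target hy1
    · rintro ⟨hz1, hz2⟩
      have hz2' : h (e'.symm z) ∈ e.source := hz2
      refine ⟨e (h (e'.symm z)), ⟨e.map_source hz2', ?_⟩, ?_⟩
      · simp only [Set.mem_preimage, e.left_inv hz2', hfh]
        exact e'.map_target hz1
      · simp only [hψ, Function.comp_apply, e.left_inv hz2', hfh, e'.right_inv hz1]
  have hinj : Set.InjOn ψ S := by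
    rintro y ⟨hy1, hy2⟩ z ⟨hz1, hz2⟩ hyz
    have h1 := e'.injOn hy2 hz2 hyz
    have h2 : e.symm y = e.symm z := by rw [← hhf (e.symm y), h1, hhf]
    exact e.symm.injOn hy1 hz1 h2
  have hψs : ContMDiffOn (𝓡 n) (𝓡 n) ∞ ψ S :=
    he1.comp (hf.comp_contMDiffOn (he.mono Set.inter_subset_left)) fun y hy ↦ hy.2
  have hψd : ∀ y ∈ S, DifferentiableAt ℝ ψ y := fun y hy ↦
    (hψs.contDiffOn.differentiableOn (by simp)).differentiableAt (hSo.mem_nhds hy)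
  have hleft : ∫ y in e.target, w (e.symm y) * w' (f (e.symm y)) * g.mapDensity (f ∘ e.symm) y
      = ∫ y in S, w (e.symm y) * w' (f (e.symm y)) * g.mapDensity (f ∘ e.symm) y := by
    refine setIntegral_eq_of_subset_of_forall_sdiff_eq_zero e.open_target.measurableSet
      Set.inter_subset_left fun y hy ↦ ?_
    rw [hw' _ fun h ↦ hy.2 ⟨hy.1, h⟩, mul_zero, zero_mul]
  have hright : ∫ z in e'.target, w (h (e'.symm z)) * w' (e'.symm z) * g.mapDensity e'.symm z
      = ∫ z in ψ '' S, w (h (e'.symm z)) * w' (e'.symm z) * g.mapDensity e'.symm z := by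
    rw [himage]
    refine setIntegral_eq_of_subset_of_forall_sdiff_eq_zero e'.open_target.measurableSet
      Set.inter_subset_left fun z hz ↦ ?_
    rw [hw _ fun h ↦ hz.2 ⟨hz.1, h⟩, zero_mul, zero_mul]
  rw [hleft, hright, integral_image_eq_integral_abs_det_fderiv_smul volume hSo.measurableSet
    (fun y hy ↦ (hψd y hy).hasFDerivAt.hasFDerivWithinAt) hinj]
  refine setIntegral_congr_fun hSo.measurableSet fun y hy ↦ ?_
  have hsymm : ∀ z ∈ S, e'.symm (ψ z) = f (e.symm z) := fun z hz ↦ e'.left_inv hz.2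
  have hdens : g.mapDensity (f ∘ e.symm) y = g.mapDensity (e'.symm ∘ ψ) y := by
    have heq : f ∘ e.symm =ᶠ[𝓝 y] e'.symm ∘ ψ := by
      filter_upwards [hSo.mem_nhds hy] with z hz using (hsymm z hz).symm
    exact g.mapDensity_congr heq
  have hψy : ψ y ∈ e'.target := e'.map_source hy.2
  simp only [hsymm y hy, hhf, smul_eq_mul]
  rw [hdens, g.mapDensity_comp_right
    ((he2.contMDiffAt (e'.open_target.mem_nhds hψy)).mdifferentiableAt (by simp)) (hψd y hy)]
  ring

/-- A diffeomorphism of a compact manifold preserves the total volume: the pullback of the volume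
element has the same integral as the volume element. -/
lemma LorentzianMetric.sum_setIntegral_mapDensity_comp [CompactSpace M] (g : LorentzianMetric n M)
    {f h : M → M} (hf : ContMDiff (𝓡 n) (𝓡 n) ∞ f) (hh : Continuous h) (hhf : ∀ x, h (f x) = x)
    (hfh : ∀ x, f (h x) = x) {s : Finset M} {ρ : M → M → ℝ} (hρc : ∀ c, Continuous (ρ c))
    (hρ : ∀ c, tsupport (ρ c) ⊆ (chartAt (EuclideanSpace ℝ (Fin n)) c).source)
    (hρ1 : ∀ x, ∑ c ∈ s, ρ c x = 1) :
    ∑ c ∈ s, ∫ y in (chartAt (EuclideanSpace ℝ (Fin n)) c).target,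
      ρ c ((chartAt (EuclideanSpace ℝ (Fin n)) c).symm y)
        * g.mapDensity (f ∘ (chartAt (EuclideanSpace ℝ (Fin n)) c).symm) y
    = ∑ c ∈ s, ∫ y in (chartAt (EuclideanSpace ℝ (Fin n)) c).target,
      ρ c ((chartAt (EuclideanSpace ℝ (Fin n)) c).symm y)
        * g.mapDensity (chartAt (EuclideanSpace ℝ (Fin n)) c).symm y := by
  have hρ0 : ∀ c, ∀ x ∉ (chartAt (EuclideanSpace ℝ (Fin n)) c).source, ρ c x = 0 :=
    fun c x hx ↦ image_eq_zero_of_notMem_tsupport fun h ↦ hx (hρ c h)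
  have hsymm : ∀ c, ContMDiffOn (𝓡 n) (𝓡 n) ∞ (chartAt (EuclideanSpace ℝ (Fin n)) c).symm
      (chartAt (EuclideanSpace ℝ (Fin n)) c).target := fun c : M ↦ contMDiffOn_chart_symm
  have hsub1 : ∀ a b : M → ℝ, tsupport (fun x ↦ a x * b x) ⊆ tsupport a :=
    fun a b ↦ tsupport_mul_subset_left
  have hsub2 : ∀ a b : M → ℝ, tsupport (fun x ↦ a x * b x) ⊆ tsupport b :=
    fun a b ↦ tsupport_mul_subset_right
  -- Inserting the partition a second time, composed with `f`, makes each term involve one chart in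
  -- the source and one in the target, as the chart formula requires. After exchanging the sums, the
  -- partition composed with `h` adds up to 1.
  have hleft : ∀ c ∈ s, ∫ y in (chartAt (EuclideanSpace ℝ (Fin n)) c).target,
        ρ c ((chartAt (EuclideanSpace ℝ (Fin n)) c).symm y)
          * g.mapDensity (f ∘ (chartAt (EuclideanSpace ℝ (Fin n)) c).symm) y
      = ∑ c' ∈ s, ∫ y in (chartAt (EuclideanSpace ℝ (Fin n)) c).target,
        ρ c ((chartAt (EuclideanSpace ℝ (Fin n)) c).symm y)
          * ρ c' (f ((chartAt (EuclideanSpace ℝ (Fin n)) c).symm y))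
          * g.mapDensity (f ∘ (chartAt (EuclideanSpace ℝ (Fin n)) c).symm) y := by
    intro c _
    rw [← integral_finsetSum]
    · simp only [← Finset.sum_mul, ← Finset.mul_sum, hρ1, mul_one]
    · intro c' _
      exact integrableOn_chart (w := fun x ↦ ρ c x * ρ c' (f x))
        ((hρc c).mul ((hρc c').comp hf.continuous)) ((hsub1 _ _).trans (hρ c))
        (g.continuousOn_mapDensity (chartAt _ c).open_target (hf.comp_contMDiffOn (hsymm c)))
  have hright : ∀ c' ∈ s, ∑ c ∈ s, ∫ y in (chartAt (EuclideanSpace ℝ (Fin n)) c').target,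
        ρ c (h ((chartAt (EuclideanSpace ℝ (Fin n)) c').symm y))
          * ρ c' ((chartAt (EuclideanSpace ℝ (Fin n)) c').symm y)
          * g.mapDensity (chartAt (EuclideanSpace ℝ (Fin n)) c').symm y
      = ∫ y in (chartAt (EuclideanSpace ℝ (Fin n)) c').target,
        ρ c' ((chartAt (EuclideanSpace ℝ (Fin n)) c').symm y)
          * g.mapDensity (chartAt (EuclideanSpace ℝ (Fin n)) c').symm y := by
    intro c' _
    rw [← integral_finsetSum]
    · simp only [← Finset.sum_mul, hρ1, one_mul]
    · intro c _
      exact integrableOn_chart (w := fun x ↦ ρ c (h x) * ρ c' x)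
        (((hρc c).comp hh).mul (hρc c')) ((hsub2 _ _).trans (hρ c'))
        (g.continuousOn_mapDensity (chartAt _ c').open_target (hsymm c'))
  rw [Finset.sum_congr rfl hleft, Finset.sum_comm, ← Finset.sum_congr rfl hright]
  exact Finset.sum_congr rfl fun c' _ ↦ Finset.sum_congr rfl fun c _ ↦
    g.setIntegral_mapDensity_chart hf hhf hfh (hρ0 c) (hρ0 c')

end MapDensity

/-! ### Bounded convex functions on the line -/

section Convex

/-- A convex function on the real line which is bounded above is constant. -/
lemma ConvexOn.eq_of_le {F : ℝ → ℝ} (hF : ConvexOn ℝ Set.univ F) {C : ℝ} (hC : ∀ t, F t ≤ C)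
    (a b : ℝ) : F a = F b := by
  have key : ∀ a b : ℝ, a ≠ b → F b ≤ F a := by
    intro a b hab
    by_contra! hlt
    -- Extrapolate the rising chord: `b` divides the segment from `a` to a + (m+1)(b-a), so F there
    -- is at least F a + (m+1)(F b - F a), which exceeds `C` for this `m`.
    obtain ⟨m, hm⟩ := exists_nat_gt ((C - F a) / (F b - F a))
    have hpos : 0 < F b - F a := sub_pos.2 hlt
    rw [div_lt_iff₀ hpos] at hm
    have h1 := hF.2 (Set.mem_univ a) (Set.mem_univ (a + (m + 1) * (b - a)))
      (show (0 : ℝ) ≤ (m : ℝ) / (m + 1) by positivity)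
      (show (0 : ℝ) ≤ 1 / ((m : ℝ) + 1) by positivity) (by field_simp)
    have h2 : ((m : ℝ) / (m + 1)) • a + (1 / ((m : ℝ) + 1)) • (a + (m + 1) * (b - a)) = b := by
      simp only [smul_eq_mul]
      field_simp
      ring
    rw [h2, smul_eq_mul, smul_eq_mul] at h1
    have h3 : ((m : ℝ) + 1) * F b ≤ m * F a + F (a + (m + 1) * (b - a)) := by
      calc _ ≤ ((m : ℝ) + 1) * (m / (m + 1) * F a + 1 / (m + 1) * F (a + (m + 1) * (b - a))) := by
            gcongr
        _ = _ := by field_simp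
    nlinarith [hC (a + (m + 1) * (b - a))]
  rcases eq_or_ne a b with rfl | hab
  · rfl
  · exact le_antisymm (key b a hab.symm) (key a b hab)

end Convex

/-! ### Convexity against constant total volume -/

section TotalVolume

open MeasureTheory

variable {n : ℕ} {M : Type*} [TopologicalSpace M] [ChartedSpace (EuclideanSpace ℝ (Fin n)) M]
  [IsManifold (𝓡 n) ∞ M] [CompactSpace M] [T2Space M]

/-- If the volume element is mid-point convex along a flow on a compact manifold then it is
mid-point affine, because the total volume does not change. -/
lemma framePullback_midpoint_eq (g : LorentzianMetric n M) {φ : Flow ℝ M}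
    (hφ : ContMDiff (𝓘(ℝ, ℝ).prod (𝓡 n)) (𝓡 n) ∞ (fun p : ℝ × M ↦ φ p.1 p.2)) {a b m : ℝ}
    (hconv : ∀ x v, 2 * framePullback (φ m) g.volumeElement x v
      ≤ framePullback (φ a) g.volumeElement x v + framePullback (φ b) g.volumeElement x v)
    (x : M) (v : Fin n → TangentSpace (𝓡 n) x) :
    2 * framePullback (φ m) g.volumeElement x v
      = framePullback (φ a) g.volumeElement x v + framePullback (φ b) g.volumeElement x v := by
  obtain ⟨s, ρ, hρc, hρ0, hρ, hρ1⟩ := exists_finite_chart_partition n M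
  have hsm := Flow.contMDiff_time hφ
  have hsymm : ∀ c, ContMDiffOn (𝓡 n) (𝓡 n) ∞ (chartAt (EuclideanSpace ℝ (Fin n)) c).symm
      (chartAt (EuclideanSpace ℝ (Fin n)) c).target := fun c : M ↦ contMDiffOn_chart_symm
  have hvol : ∀ t, ∑ c ∈ s, ∫ y in (chartAt (EuclideanSpace ℝ (Fin n)) c).target,
      ρ c ((chartAt (EuclideanSpace ℝ (Fin n)) c).symm y)
        * g.mapDensity (φ t ∘ (chartAt (EuclideanSpace ℝ (Fin n)) c).symm) y
      = ∑ c ∈ s, ∫ y in (chartAt (EuclideanSpace ℝ (Fin n)) c).target,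
      ρ c ((chartAt (EuclideanSpace ℝ (Fin n)) c).symm y)
        * g.mapDensity (chartAt (EuclideanSpace ℝ (Fin n)) c).symm y := fun t ↦
    g.sum_setIntegral_mapDensity_comp (hsm t) (hsm (-t)).continuous
      (fun x ↦ by rw [← φ.map_add, neg_add_cancel, φ.map_zero_apply])
      (fun x ↦ by rw [← φ.map_add, add_neg_cancel, φ.map_zero_apply]) hρc hρ hρ1
  have hcont : ∀ t c, ContinuousOn
      (g.mapDensity (φ t ∘ (chartAt (EuclideanSpace ℝ (Fin n)) c).symm))
      (chartAt (EuclideanSpace ℝ (Fin n)) c).target := fun t c ↦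
    g.continuousOn_mapDensity (chartAt _ c).open_target ((hsm t).comp_contMDiffOn (hsymm c))
  have hint := fun t c ↦ integrableOn_chart (hρc c) (hρ c) (hcont t c)
  set D : M → EuclideanSpace ℝ (Fin n) → ℝ := fun c y ↦
    g.mapDensity (φ a ∘ (chartAt (EuclideanSpace ℝ (Fin n)) c).symm) y
      + g.mapDensity (φ b ∘ (chartAt (EuclideanSpace ℝ (Fin n)) c).symm) y
      - 2 * g.mapDensity (φ m ∘ (chartAt (EuclideanSpace ℝ (Fin n)) c).symm) y with hD
  have hcomp : ∀ t c, ∀ y ∈ (chartAt (EuclideanSpace ℝ (Fin n)) c).target,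
      g.mapDensity (φ t ∘ (chartAt (EuclideanSpace ℝ (Fin n)) c).symm) y
      = framePullback (φ t) g.volumeElement ((chartAt (EuclideanSpace ℝ (Fin n)) c).symm y)
        (fun i ↦ mfderiv (𝓡 n) (𝓡 n) (chartAt (EuclideanSpace ℝ (Fin n)) c).symm y
          (coordFrame y i)) := fun t c y hy ↦
    g.mapDensity_comp (Flow.mdifferentiable_time hφ t _)
      (((hsymm c).contMDiffAt ((chartAt _ c).open_target.mem_nhds hy)).mdifferentiableAt (by simp))
  have hD0 : ∀ c, ∀ y ∈ (chartAt (EuclideanSpace ℝ (Fin n)) c).target, 0 ≤ D c y := by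
    intro c y hy
    simp only [hD, hcomp _ c y hy]
    linarith [hconv ((chartAt (EuclideanSpace ℝ (Fin n)) c).symm y)
      (fun i ↦ mfderiv (𝓡 n) (𝓡 n) (chartAt (EuclideanSpace ℝ (Fin n)) c).symm y
          (coordFrame y i))]
  have hDc : ∀ c, ContinuousOn (D c) (chartAt (EuclideanSpace ℝ (Fin n)) c).target := fun c ↦
    ((hcont a c).add (hcont b c)).sub (continuousOn_const.mul (hcont m c))
  have hDint := fun c ↦ integrableOn_chart (hρc c) (hρ c) (hDc c)
  have hnn : ∀ c, 0 ≤ᵐ[volume.restrict (chartAt (EuclideanSpace ℝ (Fin n)) c).target]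
      fun y ↦ ρ c ((chartAt (EuclideanSpace ℝ (Fin n)) c).symm y) * D c y := fun c ↦
    (ae_restrict_iff' (chartAt _ c).open_target.measurableSet).2
      (Filter.Eventually.of_forall fun y hy ↦ mul_nonneg (hρ0 c _) (hD0 c y hy))
  have hsum : ∑ c ∈ s, ∫ y in (chartAt (EuclideanSpace ℝ (Fin n)) c).target,
      ρ c ((chartAt (EuclideanSpace ℝ (Fin n)) c).symm y) * D c y = 0 := by
    have h1 : ∀ c, ∫ y in (chartAt (EuclideanSpace ℝ (Fin n)) c).target,
        ρ c ((chartAt (EuclideanSpace ℝ (Fin n)) c).symm y) * D c y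
        = (∫ y in (chartAt (EuclideanSpace ℝ (Fin n)) c).target,
            ρ c ((chartAt (EuclideanSpace ℝ (Fin n)) c).symm y)
              * g.mapDensity (φ a ∘ (chartAt (EuclideanSpace ℝ (Fin n)) c).symm) y)
          + (∫ y in (chartAt (EuclideanSpace ℝ (Fin n)) c).target,
            ρ c ((chartAt (EuclideanSpace ℝ (Fin n)) c).symm y)
              * g.mapDensity (φ b ∘ (chartAt (EuclideanSpace ℝ (Fin n)) c).symm) y)
          - 2 * ∫ y in (chartAt (EuclideanSpace ℝ (Fin n)) c).target,
            ρ c ((chartAt (EuclideanSpace ℝ (Fin n)) c).symm y)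
              * g.mapDensity (φ m ∘ (chartAt (EuclideanSpace ℝ (Fin n)) c).symm) y := by
      intro c
      rw [← integral_const_mul, ← integral_add (hint a c) (hint b c)]
      refine Eq.trans ?_ (integral_sub ((hint a c).add (hint b c)) ((hint m c).const_mul 2))
      congr 1
      funext y
      simp only [hD]
      ring
    -- Each of the three sums is the total volume, with coefficients 1 + 1 - 2 = 0.
    simp only [h1, Finset.sum_sub_distrib, Finset.sum_add_distrib, ← Finset.mul_sum, hvol]
    ring
  have hzero : ∀ c ∈ s, ∀ y ∈ (chartAt (EuclideanSpace ℝ (Fin n)) c).target,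
      ρ c ((chartAt (EuclideanSpace ℝ (Fin n)) c).symm y) * D c y = 0 := by
    intro c hc
    have h1 := (Finset.sum_eq_zero_iff_of_nonneg fun c _ ↦ integral_nonneg_of_ae (hnn c)).1 hsum c hc
    rw [setIntegral_eq_zero_iff_of_nonneg_ae (hnn c) (hDint c)] at h1
    -- Continuity on the open chart target upgrades vanishing almost everywhere to vanishing at
    -- every point.
    exact Measure.eqOn_open_of_ae_eq h1 (chartAt _ c).open_target
      (((hρc c).comp_continuousOn (chartAt _ c).continuousOn_symm).mul (hDc c)) continuousOn_const
  obtain ⟨c, hc, hcx⟩ : ∃ c ∈ s, ρ c x ≠ 0 := by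
    by_contra! h0
    exact zero_ne_one ((Finset.sum_eq_zero h0).symm.trans (hρ1 x))
  have hxs : x ∈ (chartAt (EuclideanSpace ℝ (Fin n)) c).source := hρ c (subset_tsupport _ hcx)
  set y := chartAt (EuclideanSpace ℝ (Fin n)) c x with hy
  have hyt : y ∈ (chartAt (EuclideanSpace ℝ (Fin n)) c).target := (chartAt _ c).map_source hxs
  have hyx : (chartAt (EuclideanSpace ℝ (Fin n)) c).symm y = x := (chartAt _ c).left_inv hxs
  have hDy : D c y = 0 := by
    refine (mul_eq_zero.1 (hzero c hc y hyt)).resolve_left ?_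
    rwa [hyx]
  simp only [hD, hcomp _ c y hyt] at hDy
  have hed := mdifferentiable_chart (I := 𝓡 n) c
  -- The derivative of the inverse chart has the derivative of the chart as right inverse, so the
  -- chart frame spans and the identity on it passes to every tuple.
  have hframe : ∀ v : Fin n → TangentSpace (𝓡 n) ((chartAt (EuclideanSpace ℝ (Fin n)) c).symm y),
      ∃ Q : Matrix (Fin n) (Fin n) ℝ, v = fun i ↦ ∑ k, Q i k •
        mfderiv (𝓡 n) (𝓡 n) (chartAt (EuclideanSpace ℝ (Fin n)) c).symm y (coordFrame y k) := by
    intro v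
    obtain ⟨A, hA⟩ : ∃ A, (mfderiv (𝓡 n) (𝓡 n) (chartAt (EuclideanSpace ℝ (Fin n)) c).symm y).comp A
        = ContinuousLinearMap.id ℝ _ := ⟨_, hed.symm_comp_deriv hxs⟩
    obtain ⟨Q, hQ⟩ := eq_sum_coordFrame y (fun i ↦ A (v i))
    refine ⟨Q, funext fun i ↦ ?_⟩
    simp only [← map_smul, ← map_sum]
    rw [← congrFun hQ i]
    exact (congrArg (fun L ↦ L (v i)) hA).symm
  have hat : ∀ v : Fin n → TangentSpace (𝓡 n) ((chartAt (EuclideanSpace ℝ (Fin n)) c).symm y),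
      2 * framePullback (φ m) g.volumeElement _ v
        = framePullback (φ a) g.volumeElement _ v + framePullback (φ b) g.volumeElement _ v := by
    intro v
    obtain ⟨Q, rfl⟩ := hframe v
    simp only [framePullback_volumeElement_comp]
    linear_combination (-|Q.det|) * hDy
  -- With `y` opaque, `x` can be replaced by its chart expression, which aligns the types of the
  -- tangent vectors.
  clear_value y
  subst hyx
  exact hat v

end TotalVolume

/-! ### Vanishing of the expansion rate -/

section Main

variable {n : ℕ} {M : Type*} [TopologicalSpace M] [ChartedSpace (EuclideanSpace ℝ (Fin n)) M]
  [IsManifold (𝓡 n) ∞ M]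

/-- If the volume element is convex along a flow on a compact manifold then the rate of volumetric
expansion vanishes along the flow. -/
lemma framePullback_expansionRate_eq_zero_of_convexOn [CompactSpace M] [T2Space M]
    (g : LorentzianMetric n M) {φ : Flow ℝ M}
    (hφ : ContMDiff (𝓘(ℝ, ℝ).prod (𝓡 n)) (𝓡 n) ∞ (fun p : ℝ × M ↦ φ p.1 p.2))
    (hconv : ∀ x v, ConvexOn ℝ Set.univ fun t : ℝ ↦ framePullback (φ t) g.volumeElement x v)
    (x : M) (v : Fin n → TangentSpace (𝓡 n) x) (t : ℝ) :
    framePullback (φ t) (expansionRate g φ) x v = 0 := by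
  have hmid : ∀ t, 2 * framePullback (φ 0) g.volumeElement x v
      = framePullback (φ t) g.volumeElement x v + framePullback (φ (-t)) g.volumeElement x v := by
    intro t
    refine framePullback_midpoint_eq g hφ (fun x v ↦ ?_) x v
    have h := (hconv x v).2 (Set.mem_univ t) (Set.mem_univ (-t)) (show (0 : ℝ) ≤ 1 / 2 by norm_num)
      (show (0 : ℝ) ≤ 1 / 2 by norm_num) (by norm_num)
    simp only [smul_eq_mul] at h
    rw [show (1 / 2 * t + 1 / 2 * -t : ℝ) = 0 by ring] at h
    linarith
  -- In V(t) + V(-t) = 2 V(0), dropping V(-t) ≥ 0 bounds V above.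
  have hconst := (hconv x v).eq_of_le (C := 2 * framePullback (φ 0) g.volumeElement x v)
    fun t ↦ by
      linarith [hmid t, framePullback_volumeElement_nonneg g (φ (-t)) x v]
  refine (hasDerivAt_framePullback_volumeElement g hφ x v t).unique ?_
  exact (hasDerivAt_const t (framePullback (φ t) g.volumeElement x v)).congr_of_eventuallyEq
    (Filter.Eventually.of_forall fun s ↦ hconst s t)

/-- If the rate of volumetric expansion never increases along a flow then it vanishes along the
flow: the volume element is concave and positive along each trajectory. -/
lemma framePullback_expansionRate_eq_zero_of_antitone
    (g : LorentzianMetric n M) {φ : Flow ℝ M}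
    (hφ : ContMDiff (𝓘(ℝ, ℝ).prod (𝓡 n)) (𝓡 n) ∞ (fun p : ℝ × M ↦ φ p.1 p.2))
    (x : M) (v : Fin n → TangentSpace (𝓡 n) x)
    (hanti : Antitone fun t : ℝ ↦ framePullback (φ t) (expansionRate g φ) x v) (t : ℝ) :
    framePullback (φ t) (expansionRate g φ) x v = 0 := by
  have hd := fun t ↦ (hasDerivAt_framePullback_volumeElement g hφ x v t).neg
  have hconv : ConvexOn ℝ Set.univ fun t : ℝ ↦ -framePullback (φ t) g.volumeElement x v := by
    refine Monotone.convexOn_univ_of_deriv (fun t ↦ (hd t).differentiableAt) ?_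
    rw [show deriv (fun t : ℝ ↦ -framePullback (φ t) g.volumeElement x v) = _ from
      funext fun t ↦ (hd t).deriv]
    exact hanti.neg
  have hconst := hconv.eq_of_le (C := 0)
    fun t ↦ neg_nonpos.2 (framePullback_volumeElement_nonneg g (φ t) x v)
  refine neg_eq_zero.1 ((hd t).unique ?_)
  exact (hasDerivAt_const t (-framePullback (φ t) g.volumeElement x v)).congr_of_eventuallyEq
    (Filter.Eventually.of_forall fun s ↦ hconst s t)

/-- If the rate of volumetric expansion never decreases along a flow then the volume element is
convex along it. -/
lemma convexOn_framePullback_of_monotone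
    (g : LorentzianMetric n M) {φ : Flow ℝ M}
    (hφ : ContMDiff (𝓘(ℝ, ℝ).prod (𝓡 n)) (𝓡 n) ∞ (fun p : ℝ × M ↦ φ p.1 p.2))
    (x : M) (v : Fin n → TangentSpace (𝓡 n) x)
    (hmono : Monotone fun t : ℝ ↦ framePullback (φ t) (expansionRate g φ) x v) :
    ConvexOn ℝ Set.univ fun t : ℝ ↦ framePullback (φ t) g.volumeElement x v := by
  have hd := hasDerivAt_framePullback_volumeElement g hφ x v
  refine Monotone.convexOn_univ_of_deriv (fun t ↦ (hd t).differentiableAt) ?_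
  rwa [show deriv (fun t : ℝ ↦ framePullback (φ t) g.volumeElement x v) = _ from
    funext fun t ↦ (hd t).deriv]

lemma framePullback_expansionRate_eq_mul (g : LorentzianMetric n M) (φ : Flow ℝ M)
    (x : M) (v : Fin n → TangentSpace (𝓡 n) x) (t : ℝ) :
    framePullback (φ t) (expansionRate g φ) x v
      = logExpansionRate g φ (φ t x) * framePullback (φ t) g.volumeElement x v :=
  expansionRate_eq g φ _ _

lemma framePullback_flow_volumeElement_pos (g : LorentzianMetric n M) {φ : Flow ℝ M}
    (hφ : ContMDiff (𝓘(ℝ, ℝ).prod (𝓡 n)) (𝓡 n) ∞ (fun p : ℝ × M ↦ φ p.1 p.2))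
    (x : M) (t : ℝ) : 0 < framePullback (φ t) g.volumeElement x (coordFrame x) := by
  refine (framePullback_volumeElement_nonneg g _ x _).lt_of_ne' ?_
  refine framePullback_volumeElement_ne_zero g (Flow.mdifferentiable_time hφ (-t))
    (Flow.mdifferentiable_time hφ t) ?_ (volumeElement_coordFrame_ne_zero g x)
  rw [← Flow.comp_eq, neg_add_cancel]
  exact funext φ.map_zero_apply

/-- If the logarithmic rate of volumetric expansion never decreases along the trajectory of `x` then
the volume element is (even logarithmically) convex along it. -/
lemma convexOn_framePullback_of_monotone_logExpansionRate
    (g : LorentzianMetric n M) {φ : Flow ℝ M}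
    (hφ : ContMDiff (𝓘(ℝ, ℝ).prod (𝓡 n)) (𝓡 n) ∞ (fun p : ℝ × M ↦ φ p.1 p.2))
    (x : M) (v : Fin n → TangentSpace (𝓡 n) x)
    (hmono : Monotone fun t : ℝ ↦ logExpansionRate g φ (φ t x)) :
    ConvexOn ℝ Set.univ fun t : ℝ ↦ framePullback (φ t) g.volumeElement x v := by
  have hpos := framePullback_flow_volumeElement_pos g hφ x
  have hd : ∀ t, HasDerivAt
      (fun t : ℝ ↦ Real.log (framePullback (φ t) g.volumeElement x (coordFrame x)))
      (logExpansionRate g φ (φ t x)) t := by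
    intro t
    have h := (hasDerivAt_framePullback_volumeElement g hφ x (coordFrame x) t).log (hpos t).ne'
    rwa [framePullback_expansionRate_eq_mul, mul_div_cancel_right₀ _ (hpos t).ne'] at h
  have hlog : ConvexOn ℝ Set.univ
      fun t : ℝ ↦ Real.log (framePullback (φ t) g.volumeElement x (coordFrame x)) := by
    refine Monotone.convexOn_univ_of_deriv (fun t ↦ (hd t).differentiableAt) ?_
    rwa [show deriv _ = _ from funext fun t ↦ (hd t).deriv]
  have hexp : ConvexOn ℝ Set.univ
      fun t : ℝ ↦ framePullback (φ t) g.volumeElement x (coordFrame x) := by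
    -- The exponential is increasing and convex, so it preserves convexity.
    refine ⟨convex_univ, fun a _ b _ α β hα hβ hαβ ↦ ?_⟩
    have h1 := Real.exp_le_exp.2 (hlog.2 (Set.mem_univ a) (Set.mem_univ b) hα hβ hαβ)
    have h2 := convexOn_exp.2
      (Set.mem_univ (Real.log (framePullback (φ a) g.volumeElement x (coordFrame x))))
      (Set.mem_univ (Real.log (framePullback (φ b) g.volumeElement x (coordFrame x)))) hα hβ hαβ
    simpa only [Real.exp_log (hpos _)] using h1.trans h2
  -- The logarithm required a frame; on any other tuple the volume is a nonnegative constant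
  -- multiple.
  obtain ⟨P, rfl⟩ := eq_sum_coordFrame x v
  simp only [framePullback_volumeElement_comp]
  exact hexp.smul (abs_nonneg _)

/-- A unit timelike field has no zeros, so its support is all of `M`. -/
lemma compactSpace_of_timelike (g : LorentzianMetric n M) {ξ : (x : M) → TangentSpace (𝓡 n) x}
    (hunit : ∀ x, g.inner x (ξ x) (ξ x) = -1) (hsupp : IsCompact (closure {x | ξ x ≠ 0})) :
    CompactSpace M := by
  have h : {x | ξ x ≠ 0} = Set.univ := by
    refine Set.eq_univ_of_forall fun x h0 ↦ ?_
    have := hunit x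
    rw [h0] at this
    simp at this
  rw [h, closure_univ] at hsupp
  exact ⟨hsupp⟩

end Main

end

theorem corollary3 (n : ℕ) (hn : 3 ≤ n) (M : Type*) [TopologicalSpace M] [T2Space M] [Nonempty M]
    [ChartedSpace (EuclideanSpace ℝ (Fin n)) M] [IsManifold (𝓡 n) ∞ M]
    (g : LorentzianMetric n M)
    -- the velocity field: smooth, unit timelike, compactly supported
    (ξ : (x : M) → TangentSpace (𝓡 n) x)
    (hξ_smooth : ContMDiff (𝓡 n) (𝓡 n).tangent ∞
      (fun x ↦ (⟨x, ξ x⟩ : TangentBundle (𝓡 n) M)))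
    (hξ_unit : ∀ x, g.inner x (ξ x) (ξ x) = -1)
    (hξ_supp : IsCompact (closure {x | ξ x ≠ 0}))
    -- the flow: a smooth one-parameter group with velocity `ξ`
    (φ : Flow ℝ M)
    (hφ_smooth : ContMDiff (𝓘(ℝ, ℝ).prod (𝓡 n)) (𝓡 n) ∞ (fun p : ℝ × M ↦ φ p.1 p.2))
    (hφ : ∀ x, IsMIntegralCurve (I := 𝓡 n) (fun t ↦ φ t x) ξ) :
    ¬ FrameFieldIncreases φ (expansionRate g φ) ∧
    ¬ FrameFieldDecreases φ (expansionRate g φ) ∧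
    ¬ FunctionIncreases φ (logExpansionRate g φ) := by
  have := compactSpace_of_timelike g hξ_unit hξ_supp
  refine ⟨?_, ?_, ?_⟩
  · rintro ⟨hmono, x, v, s, t, -, hlt⟩
    have h0 := framePullback_expansionRate_eq_zero_of_convexOn g hφ_smooth
      (fun x v ↦ convexOn_framePullback_of_monotone g hφ_smooth x v (hmono x v)) x v
    rw [h0, h0] at hlt
    exact lt_irrefl _ hlt
  · rintro ⟨hanti, x, v, s, t, -, hlt⟩
    have h0 := framePullback_expansionRate_eq_zero_of_antitone g hφ_smooth x v (hanti x v)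
    rw [h0, h0] at hlt
    exact lt_irrefl _ hlt
  · rintro ⟨hmono, x, s, t, -, hlt⟩
    have h0 : ∀ t, logExpansionRate g φ (φ t x) = 0 := by
      intro t
      have h := framePullback_expansionRate_eq_zero_of_convexOn g hφ_smooth
        (fun x v ↦ convexOn_framePullback_of_monotone_logExpansionRate g hφ_smooth x v (hmono x))
        x (coordFrame x) t
      rw [framePullback_expansionRate_eq_mul] at h
      exact (mul_eq_zero.1 h).resolve_right
        (framePullback_flow_volumeElement_pos g hφ_smooth x t).ne'
    rw [h0, h0] at hlt
    exact lt_irrefl _ hlt
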